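/- Let $M$ be a lattice (a free abelian group) of finite rank $n$, write $M_{\mathbb R}=M\otimes_{\mathbb Z}\mathbb R$, and let $\mathrm{vol}_M$ be the Haar measure on $M_{\mathbb R}$ for which a fundamental domain of $M$ has volume $1$. For concave functions $g_0,\dots,g_n:M_{\mathbb R}\to\mathbb R\cup\{-\infty\}$ whose domains (the sets on which they are finite) are the convex bodies $Q_0,\dots,Q_n$, put $$\mathrm{MI}_M(g_0,\dots,g_n):=\sum_{k=0}^n(-1)^{n-k}\sum_{0\le i_0<\dots<i_k\le n}\int_{Q_{i_0}+\dots+Q_{i_k}}(g_{i_0}\boxplus\dots\boxplus g_{i_k})\,d\mathrm{vol}_M,$$ where $(f\boxplus g)(v)=\sup_{u_1+u_2=v}(f(u_1)+g(u_2))$ is the sup-convolution. Let $m\in M$ be primitive, that is, $m\neq0$ and there is no $m'\in M$ with $m'\neq m$ and $km'=m$ for some positive integer $k$. Then $P:=M/\mathbb Zm$ is a lattice of rank $n-1$; let $\pi:M_{\mathbb R}\to P_{\mathbb R}$ be the linear map induced by the projection $M\to P$. For $i=1,\dots,n$ let $g_i:Q_i\to\mathbb R$ be a continuous concave function on a nonempty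 polytope $Q_i\subset M_{\mathbb R}$ (a bounded intersection of finitely many closed half-spaces), extended by $-\infty$ outside $Q_i$. Let $\pi_*g_i:\pi(Q_i)\to\mathbb R$, $x\mapsto\max_{y\in Q_i,\ \pi(y)=x}g_i(y)$, again extended by $-\infty$, and let $\iota_{\overline{0m}}$ be the function equal to $0$ on the segment $\overline{0m}$ from $0$ to $m$ and to $-\infty$ elsewhere. Then $$\mathrm{MI}_M\big(\iota_{\overline{0m}},g_1,\dots,g_n\big)=\mathrm{MI}_P\big(\pi_*g_1,\dots,\pi_*g_n\big).$$ -/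

import Mathlib

open MeasureTheory TensorProduct
open scoped Pointwise

/-- The real vector space `L_ℝ = ℝ ⊗ L` spanned by a lattice `L`. -/
def RealSpace (L : Type*) [AddCommGroup L] : Type _ := ℝ ⊗[ℤ] L

section RealSpace

noncomputable instance RealSpace.instAddCommGroup (L : Type*) [AddCommGroup L] :
    AddCommGroup (RealSpace L) :=
  inferInstanceAs (AddCommGroup (ℝ ⊗[ℤ] L))

noncomputable instance RealSpace.instModule (L : Type*) [AddCommGroup L] :
    Module ℝ (RealSpace L) :=
  inferInstanceAs (Module ℝ (ℝ ⊗[ℤ] L))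

/-- The module topology; for a lattice `L` of finite rank this is the usual topology of the
finite-dimensional real vector space `L_ℝ`. -/
noncomputable instance RealSpace.instTopologicalSpace (L : Type*) [AddCommGroup L] :
    TopologicalSpace (RealSpace L) :=
  moduleTopology ℝ (RealSpace L)

instance RealSpace.instIsModuleTopology (L : Type*) [AddCommGroup L] :
    IsModuleTopology ℝ (RealSpace L) :=
  ⟨rfl⟩

noncomputable instance RealSpace.instMeasurableSpace (L : Type*) [AddCommGroup L] :
    MeasurableSpace (RealSpace L) :=
  borel (RealSpace L)

instance RealSpace.instBorelSpace (L : Type*) [AddCommGroup L] :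
    BorelSpace (RealSpace L) :=
  ⟨rfl⟩

/-- The canonical map `L → L_ℝ`, `x ↦ 1 ⊗ x`. -/
noncomputable def RealSpace.of {L : Type*} [AddCommGroup L] (x : L) : RealSpace L :=
  (1 : ℝ) ⊗ₜ[ℤ] x

/-- The `ℝ`-linear map `L_ℝ → L'_ℝ` induced by a homomorphism `L → L'`. -/
noncomputable def RealSpace.map {L L' : Type*} [AddCommGroup L] [AddCommGroup L']
    (p : L →+ L') : RealSpace L →ₗ[ℝ] RealSpace L' :=
  LinearMap.baseChange ℝ p.toIntLinearMap

/-- The `ℝ`-basis of `L_ℝ` given by a `ℤ`-basis of `L`. -/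
noncomputable def RealSpace.basis {L ι : Type*} [AddCommGroup L] (b : Module.Basis ι ℤ L) :
    Module.Basis ι ℝ (RealSpace L) :=
  Algebra.TensorProduct.basis ℝ b

end RealSpace

/-- The measure `vol_L` on `L_ℝ`: the Haar measure giving volume `1` to a fundamental domain
of `L`, that is, the Lebesgue measure in the coordinates of a `ℤ`-basis of `L` (for the
independence of the basis see `latticeVolume_eq`). If `L` has rank `0`, it is the unit mass
at the point of `L_ℝ`. -/
noncomputable def latticeVolume (L : Type*) [AddCommGroup L] [Module.Free ℤ L]
    [Module.Finite ℤ L] : Measure (RealSpace L) :=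
  Measure.map (RealSpace.basis (Module.Free.chooseBasis ℤ L)).equivFun.symm volume

theorem latticeVolume_eq {L ι : Type*} [Fintype ι] [AddCommGroup L] [Module.Free ℤ L]
    [Module.Finite ℤ L] (b : Module.Basis ι ℤ L) :
    latticeVolume L = Measure.map (RealSpace.basis b).equivFun.symm volume := by
  classical
  have := IsModuleTopology.toContinuousAdd ℝ (RealSpace L)
  have meas : ∀ a : Module.Basis ι ℤ L, Measurable (RealSpace.basis a).equivFun.symm := fun a =>
    (IsModuleTopology.continuous_of_linearMap
      (RealSpace.basis a).equivFun.symm.toLinearMap).measurable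
  unfold latticeVolume
  generalize Module.Free.chooseBasis ℤ L = c
  let e := c.indexEquiv b
  have h1 : Measure.map (RealSpace.basis c).equivFun.symm volume =
      Measure.map (RealSpace.basis (c.reindex e)).equivFun.symm volume := by
    rw [← (volume_measurePreserving_piCongrLeft (fun _ : ι => ℝ) e).map_eq,
      Measure.map_map (meas (c.reindex e))
        (MeasurableEquiv.measurable _)]
    congr 1
    funext x
    simp only [Function.comp, Module.Basis.equivFun_symm_apply]
    rw [← e.sum_comp]
    refine Finset.sum_congr rfl fun i _ => ?_
    rw [MeasurableEquiv.coe_piCongrLeft, Equiv.piCongrLeft_apply_apply]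
    congr 1
    refine (Algebra.TensorProduct.basis_apply c i).trans
      (Eq.trans ?_ (Algebra.TensorProduct.basis_apply (c.reindex e) (e i)).symm)
    simp
  rw [h1]
  generalize c.reindex e = d
  let T : (ι → ℝ) →ₗ[ℝ] (ι → ℝ) := Matrix.toLin' ((b.toMatrix d).map (Int.castRingHom ℝ))
  have hdet : LinearMap.det T = ((b.toMatrix d).det : ℤ) := by
    simp only [T, LinearMap.det_toLin']
    exact ((Int.castRingHom ℝ).map_det _).symm
  have hunit : IsUnit (b.toMatrix d).det := by
    have := b.toMatrix_mul_toMatrix_flip d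
    exact IsUnit.of_mul_eq_one (d.toMatrix b).det (by rw [← Matrix.det_mul, this, Matrix.det_one])
  have habs : |LinearMap.det T| = 1 := by
    rw [hdet]
    rcases Int.isUnit_iff.1 hunit with h | h <;> simp [h]
  have hne : LinearMap.det T ≠ 0 := fun h => by simp [h] at habs
  have hT : Measure.map T volume = volume := by
    rw [Real.map_linearMap_volume_pi_eq_smul_volume_pi hne, abs_inv, habs]
    simp
  conv_rhs => rw [← hT]
  rw [Measure.map_map (meas b)
    T.continuous_of_finiteDimensional.measurable]
  congr 1
  have : (RealSpace.basis d).equivFun.symm.toLinearMap =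
      (RealSpace.basis b).equivFun.symm.toLinearMap ∘ₗ T := by
    refine LinearMap.pi_ext' fun i => LinearMap.ext_ring ?_
    simp only [LinearMap.comp_apply, LinearEquiv.coe_coe, LinearMap.single_apply, T,
      Matrix.toLin'_apply, Matrix.mulVec_single_one, Module.Basis.equivFun_symm_apply]
    simp only [Pi.single_apply, ite_smul, one_smul, zero_smul, Finset.sum_ite_eq',
      Finset.mem_univ, if_true, Matrix.col_apply, Matrix.map_apply]
    have hd : d i = ∑ j, b.toMatrix d j i • b j := (b.sum_toMatrix_smul_self d i).symm
    have e1 : ∀ (a : Module.Basis ι ℤ L) (j : ι), RealSpace.basis a j = (1 : ℝ) ⊗ₜ[ℤ] a j :=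
      fun a j => Algebra.TensorProduct.basis_apply a j
    rw [e1, hd]
    simp only [e1]
    refine (TensorProduct.tmul_sum (R := ℤ) (1 : ℝ) Finset.univ _).trans ?_
    refine Finset.sum_congr rfl fun j _ => ?_
    rw [TensorProduct.tmul_smul]
    exact (Int.cast_smul_eq_zsmul ℝ _ _).symm
  exact congrArg DFunLike.coe this

section ConcaveFunctions

variable {E F : Type*} [AddCommGroup E] [Module ℝ E] [AddCommGroup F] [Module ℝ F]

/-- Concave functions take values in `ℝ ∪ {-∞}` and are modelled as functions to `EReal`.
This is the function which is `g` on `Q` and `-∞` elsewhere. -/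
noncomputable def extendBot (Q : Set E) (g : E → ℝ) : E → EReal :=
  open Classical in fun x => if x ∈ Q then (g x : EReal) else ⊥

/-- The indicator function `ι_B`: it is `0` on `B` and `-∞` elsewhere. -/
noncomputable def concaveIndicator (B : Set E) : E → EReal :=
  extendBot B (fun _ => 0)

/-- The effective domain of a function with values in `ℝ ∪ {-∞}`. -/
def effDomain (f : E → EReal) : Set E := {x | f x ≠ ⊥}

/-- The sup-convolution of the family `f i`, `i ∈ S`: its value at `x` is the supremum of
`∑ i ∈ S, f i (y i)` over all decompositions `x = ∑ i ∈ S, y i`. -/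
noncomputable def supConv {ι : Type*} (S : Finset ι) (f : ι → E → EReal) : E → EReal :=
  fun x => ⨆ y : {y : ι → E // ∑ i ∈ S, y i = x}, ∑ i ∈ S, f i (y.1 i)

/-- The direct image `π_* f` of `f` by a linear map `π`: the fibrewise supremum. It is `-∞`
outside of the image of the domain of `f`, and a maximum whenever `f` is upper semicontinuous
with compact domain. -/
noncomputable def directImage (π : E →ₗ[ℝ] F) (f : E → EReal) : F → EReal :=
  fun x => ⨆ y : {y : E // π y = x}, f y.1

/-- The mixed integral of `k = dim E + 1` concave functions with respect to a measure `μ`: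
the alternating sum, over the nonempty sets `S` of indices, of the integrals of the
sup-convolutions of the functions indexed by `S` on the Minkowski sums of their domains. -/
noncomputable def mixedIntegral [MeasurableSpace E] (μ : Measure E) {k : ℕ}
    (f : Fin k → E → EReal) : ℝ :=
  ∑ S : Finset (Fin k) with S.Nonempty,
    (-1) ^ (k - S.card) * ∫ x in ∑ i ∈ S, effDomain (f i), (supConv S f x).toReal ∂μ

/-- A polyhedron is an intersection of finitely many closed halfspaces. -/
def IsPolyhedron (Q : Set E) : Prop :=
  ∃ s : Finset (Module.Dual ℝ E × ℝ), Q = {x | ∀ p ∈ s, 0 ≤ p.1 x + p.2}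

/-- A polytope is a bounded polyhedron. -/
def IsPolytope [TopologicalSpace E] (Q : Set E) : Prop :=
  IsPolyhedron Q ∧ Bornology.IsVonNBounded ℝ Q

end ConcaveFunctions

/-- The mixed integral `MI_L` of `k = rank L + 1` concave functions on `L_ℝ`, with respect to
`vol_L`. -/
noncomputable def latticeMixedIntegral (L : Type*) [AddCommGroup L] [Module.Free ℤ L]
    [Module.Finite ℤ L] {k : ℕ} (f : Fin k → RealSpace L → EReal) : ℝ :=
  mixedIntegral (latticeVolume L) f

/-- A lattice vector is primitive if it is nonzero and not a positive integer multiple of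
another lattice vector. -/
def IsPrimitiveVector {M : Type*} [AddCommGroup M] (m : M) : Prop :=
  m ≠ 0 ∧ ∀ (u : M) (k : ℕ), 0 < k → k • u = m → u = m

instance finite_quotient_zmultiples {M : Type*} [AddCommGroup M] [Module.Finite ℤ M] (m : M) :
    Module.Finite ℤ (M ⧸ AddSubgroup.zmultiples m) :=
  Module.Finite.of_surjective (QuotientAddGroup.mk' (AddSubgroup.zmultiples m)).toIntLinearMap
    (QuotientAddGroup.mk'_surjective _)

/-- The quotient of a lattice by a primitive vector is a lattice. -/
theorem IsPrimitiveVector.free_quotient {M : Type*} [AddCommGroup M] [Module.Free ℤ M]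
    [Module.Finite ℤ M] {m : M} (hm : IsPrimitiveVector m) :
    Module.Free ℤ (M ⧸ AddSubgroup.zmultiples m) := by
  have key : ∀ (k : ℤ) (x : M), k ≠ 0 → k • x ∈ AddSubgroup.zmultiples m →
      x ∈ AddSubgroup.zmultiples m := by
    intro k x hk hx
    obtain ⟨j, hj⟩ := AddSubgroup.mem_zmultiples_iff.1 hx
    obtain ⟨d, k', j', hd, hco, rfl, rfl⟩ :
        ∃ d k' j' : ℤ, d ≠ 0 ∧ IsCoprime k' j' ∧ k = d * k' ∧ j = d * j' := by
      have hg : 0 < Int.gcd k j := Int.gcd_pos_of_ne_zero_left _ hk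
      obtain ⟨k', j', h1, h2, h3⟩ := Int.exists_gcd_one hg
      exact ⟨Int.gcd k j, k', j', by exact_mod_cast hg.ne', Int.isCoprime_iff_gcd_eq_one.2 h1,
        by rw [mul_comm]; exact h2, by rw [mul_comm]; exact h3⟩
    have hk' : k' ≠ 0 := right_ne_zero_of_mul hk
    have h : j' • m = k' • x := by
      rw [mul_smul, mul_smul] at hj
      exact smul_right_injective M hd hj
    obtain ⟨u, v, huv⟩ := hco
    have hmk : m = k' • (u • m + v • x) := by
      calc m = (u * k' + v * j') • m := by rw [huv, one_smul]
        _ = k' • u • m + v • (j' • m) := by rw [add_smul, mul_comm u, mul_smul, mul_smul]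
        _ = k' • (u • m + v • x) := by rw [h, smul_add, smul_comm v k' x]
    have hunit : IsUnit k' := by
      have hs : k'.natAbs • (k'.sign • (u • m + v • x)) = m := by
        rw [← natCast_zsmul, ← mul_smul, mul_comm, Int.sign_mul_natAbs]
        exact hmk.symm
      have h1 := hm.2 _ _ (Int.natAbs_pos.2 hk') hs
      rw [h1, ← natCast_zsmul] at hs
      have h2 : ((k'.natAbs : ℤ) - 1) • m = 0 := by rw [sub_smul, hs, one_smul, sub_self]
      have h3 := (smul_eq_zero.1 h2).resolve_right hm.1
      exact Int.isUnit_iff_natAbs_eq.2 (by omega)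
    rcases Int.isUnit_iff.1 hunit with h1 | h1
    · exact AddSubgroup.mem_zmultiples_iff.2 ⟨j', by rw [h, h1, one_smul]⟩
    · exact AddSubgroup.mem_zmultiples_iff.2 ⟨-j', by rw [neg_smul, h, h1]; simp⟩
  have : Module.IsTorsionFree ℤ (M ⧸ AddSubgroup.zmultiples m) := by
    refine Module.IsTorsionFree.of_smul_eq_zero fun k y hky => ?_
    by_contra! hcon
    obtain ⟨x, rfl⟩ := QuotientAddGroup.mk'_surjective (AddSubgroup.zmultiples m) y
    refine hcon.2 ((QuotientAddGroup.eq_zero_iff x).2 (key k x hcon.1 ?_))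
    rw [← map_zsmul] at hky
    exact (QuotientAddGroup.eq_zero_iff _).1 hky
  exact Module.free_of_finite_type_torsion_free'

/-! Pair each index set `T` of the functions `g_i` with `T ∪ {0}`. In the alternating sum over `M`
these two sets carry opposite signs, and the sign of `T ∪ {0}` is that of `T` in the sum over `P`.
Writing `h` for the sup-convolution of the `g_i`, `i ∈ T`, it therefore suffices to show that
replacing `h` by its sup-convolution with the indicator of the segment increases the integral by
exactly the integral of `π_* h`, and that `π_* h` is the sup-convolution of the `π_* g_i`.

The second point is `supConv_directImage`. For the first, primitivity makes `P` free, so a basis of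
`P` lifts to a basis of `M` beginning with `m`. In these coordinates `π` forgets the first
coordinate and both volumes are Lebesgue measures. By Fubini the claim reduces to lines parallel to
`m` (`integral_iSup_sub_smul`). On such a line `h` is quasi-concave, and taking suprema over a
sliding unit window cuts its graph at a maximum point and inserts a plateau of length 1 there
(`integral_iSup_sub`). The gain is the maximum on the fibre, which is the value of `π_* h`.

Compactness of the domains supplies the attained suprema, measurability and integrability. -/

theorem EReal.sum_eq_bot_of_mem {ι : Type*} {S : Finset ι} {f : ι → EReal} {i : ι} (hi : i ∈ S)
    (h : f i = ⊥) : ∑ j ∈ S, f j = ⊥ := by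
  classical
  rw [← Finset.add_sum_erase S f hi, h, EReal.bot_add]

theorem EReal.coe_sum_finset {ι : Type*} (S : Finset ι) (f : ι → ℝ) :
    ((∑ i ∈ S, f i : ℝ) : EReal) = ∑ i ∈ S, (f i : EReal) := by
  classical
  induction S using Finset.induction_on with
  | empty => simp
  | insert a S ha ih => rw [Finset.sum_insert ha, Finset.sum_insert ha, EReal.coe_add, ih]

/-! ### Sup-convolution and direct image: formal properties -/

section Algebra

variable {E F ι : Type*}

theorem extendBot_of_mem {Q : Set E} {g : E → ℝ} {x : E} (hx : x ∈ Q) :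
    extendBot Q g x = g x := if_pos hx

theorem extendBot_of_notMem {Q : Set E} {g : E → ℝ} {x : E} (hx : x ∉ Q) :
    extendBot Q g x = ⊥ := if_neg hx

theorem sum_extendBot {S : Finset ι} {Q : ι → Set E} {g : ι → E → ℝ} {y : ι → E}
    (hy : ∀ i ∈ S, y i ∈ Q i) :
    ∑ i ∈ S, extendBot (Q i) (g i) (y i) = ((∑ i ∈ S, g i (y i) : ℝ) : EReal) := by
  rw [EReal.coe_sum_finset]
  exact Finset.sum_congr rfl fun i hi => extendBot_of_mem (hy i hi)

variable [AddCommGroup E] [AddCommGroup F]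

theorem le_supConv (S : Finset ι) (f : ι → E → EReal) (y : ι → E) :
    ∑ i ∈ S, f i (y i) ≤ supConv S f (∑ i ∈ S, y i) :=
  le_iSup (fun z : {z : ι → E // ∑ i ∈ S, z i = ∑ i ∈ S, y i} => ∑ i ∈ S, f i (z.1 i)) ⟨y, rfl⟩

theorem supConv_eq_bot {S : Finset ι} {f : ι → E → EReal} {x : E}
    (hx : x ∉ ∑ i ∈ S, effDomain (f i)) : supConv S f x = ⊥ := by
  refine eq_bot_iff.2 (iSup_le fun ⟨y, hy⟩ => ?_)
  by_contra hne
  refine hx ((Set.mem_finsetSum _ _ _).2 ⟨y, fun {i} hi hbot => hne ?_, hy⟩)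
  exact (EReal.sum_eq_bot_of_mem (f := fun j => f j (y j)) hi hbot).le

/-- Off the Minkowski sum of the domains the sup-convolution is `⊥`, and `EReal.toReal` sends `⊥` to
`0`. The domains of integration can thus be dropped. -/
theorem mixedIntegral_eq [MeasurableSpace E] (μ : Measure E) {k : ℕ} (f : Fin k → E → EReal) :
    mixedIntegral μ f = ∑ S : Finset (Fin k) with S.Nonempty,
      (-1) ^ (k - S.card) * ∫ x, (supConv S f x).toReal ∂μ := by
  refine Finset.sum_congr rfl fun S _ => ?_
  rw [setIntegral_eq_integral_of_forall_compl_eq_zero]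
  intro x hx
  rw [supConv_eq_bot hx, EReal.toReal_bot]

theorem supConv_map {κ : Type*} (j : κ ↪ ι) (S : Finset κ) (f : ι → E → EReal) :
    supConv (S.map j) f = supConv S (fun i => f (j i)) := by
  funext x
  refine le_antisymm (iSup_le fun ⟨y, hy⟩ => ?_) (iSup_le fun ⟨y, hy⟩ => ?_)
  · rw [Finset.sum_map] at hy ⊢
    simpa only [hy] using! le_supConv S (fun i => f (j i)) fun i => y (j i)
  · have h := le_supConv (S.map j) f (Function.extend j y 0)
    simpa [Finset.sum_map, j.injective.extend_apply, hy] using h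

variable [Module ℝ E] [Module ℝ F]

theorem le_directImage (π : E →ₗ[ℝ] F) (f : E → EReal) (y : E) :
    f y ≤ directImage π f (π y) :=
  le_iSup (fun z : {z : E // π z = π y} => f z.1) ⟨y, rfl⟩

/-- Sup-convolution with the indicator function of a segment starting at `0`. -/
theorem supConv_cons_concaveIndicator {n : ℕ} (m : E) (T : Finset (Fin n))
    (f : Fin n → E → EReal) (x : E) :
    supConv (insert 0 (T.map (Fin.succEmb n)))
        (Fin.cons (α := fun _ => E → EReal) (concaveIndicator (segment ℝ 0 m)) f) x =
      ⨆ t : Set.Icc (0 : ℝ) 1, supConv T f (x - (t : ℝ) • m) := by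
  have h0 : (0 : Fin (n + 1)) ∉ T.map (Fin.succEmb n) := by
    simp [Fin.succ_ne_zero]
  refine le_antisymm (iSup_le fun ⟨y, hy⟩ => ?_) (iSup_le fun t => iSup_le fun ⟨y, hy⟩ => ?_)
  · rw [Finset.sum_insert h0, Finset.sum_map] at hy ⊢
    simp only [Fin.cons_zero, Fin.coe_succEmb, Fin.cons_succ] at hy ⊢
    by_cases hseg : y 0 ∈ segment ℝ 0 m
    · rw [segment_eq_image'] at hseg
      obtain ⟨t, ht, hty⟩ := hseg
      simp only [zero_add, sub_zero] at hty
      have h1 : concaveIndicator (segment ℝ 0 m) (y 0) = 0 := by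
        refine (extendBot_of_mem ?_).trans EReal.coe_zero
        rw [segment_eq_image']
        exact ⟨t, ht, by simpa using hty⟩
      rw [h1, zero_add]
      refine le_trans ?_
        (le_iSup (fun t : Set.Icc (0 : ℝ) 1 => supConv T f (x - (t : ℝ) • m)) ⟨t, ht⟩)
      have h2 : x - t • m = ∑ i ∈ T, y i.succ := by rw [hty, ← hy, add_sub_cancel_left]
      rw [h2]
      exact le_supConv T f fun i => y i.succ
    · rw [show concaveIndicator (segment ℝ 0 m) (y 0) = ⊥ from extendBot_of_notMem hseg,
        EReal.bot_add]
      exact bot_le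
  · have h := le_supConv (insert 0 (T.map (Fin.succEmb n)))
      (Fin.cons (α := fun _ => E → EReal) (concaveIndicator (segment ℝ 0 m)) f)
      (Fin.cons (α := fun _ => E) ((t : ℝ) • m) y)
    rw [Finset.sum_insert h0, Finset.sum_map, Finset.sum_insert h0, Finset.sum_map] at h
    simp only [Fin.cons_zero, Fin.coe_succEmb, Fin.cons_succ] at h
    rw [hy, add_sub_cancel] at h
    refine le_trans (le_of_eq ?_) h
    have h1 : concaveIndicator (segment ℝ 0 m) ((t : ℝ) • m) = 0 := by
      refine (extendBot_of_mem ?_).trans EReal.coe_zero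
      rw [segment_eq_image']
      exact ⟨t, t.2, by simp⟩
    rw [h1, zero_add]

/-- Both sides maximize the same sum over all families whose images add up to the given point.
Attained fibre maxima (`hmax`) let a decomposition downstairs be lifted with no loss of value. -/
theorem supConv_directImage {π : E →ₗ[ℝ] F} {f : ι → E → EReal}
    (hmax : ∀ i x, ∃ y, π y = x ∧ f i y = directImage π (f i) x) (S : Finset ι) :
    supConv S (fun i => directImage π (f i)) = directImage π (supConv S f) := by
  funext x
  refine le_antisymm (iSup_le fun ⟨z, hz⟩ => ?_)
    (iSup_le fun ⟨w, hw⟩ => iSup_le fun ⟨y, hy⟩ => ?_)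
  · choose y hy using fun i => hmax i (z i)
    have h1 : π (∑ i ∈ S, y i) = x := by
      rw [map_sum, ← hz]
      exact Finset.sum_congr rfl fun i _ => (hy i).1
    calc ∑ i ∈ S, directImage π (f i) (z i) = ∑ i ∈ S, f i (y i) :=
          Finset.sum_congr rfl fun i _ => (hy i).2.symm
      _ ≤ supConv S f (∑ i ∈ S, y i) := le_supConv S f y
      _ ≤ directImage π (supConv S f) x := h1 ▸ le_directImage π _ _
  · calc ∑ i ∈ S, f i (y i) ≤ ∑ i ∈ S, directImage π (f i) (π (y i)) :=
          Finset.sum_le_sum fun i _ => le_directImage π (f i) (y i)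
      _ ≤ supConv S (fun i => directImage π (f i)) (∑ i ∈ S, π (y i)) :=
          le_supConv S (fun i => directImage π (f i)) fun i => π (y i)
      _ = _ := by rw [← map_sum, hy, hw]

end Algebra

/-- This is the pairing of `T ∪ {0}` with `T` on which the cancellation in the alternating sum
rests. -/
theorem sum_finset_fin_succ {n : ℕ} {A : Type*} [AddCommMonoid A]
    (G : Finset (Fin (n + 1)) → A) :
    ∑ S, G S = ∑ T : Finset (Fin n), G (insert 0 (T.map (Fin.succEmb n))) +
      ∑ T : Finset (Fin n), G (T.map (Fin.succEmb n)) := by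
  rw [← Finset.sum_filter_add_sum_filter_not Finset.univ (fun S => (0 : Fin (n + 1)) ∈ S)]
  congr 1
  · refine Finset.sum_nbij' (fun S => S.preimage Fin.succ (Fin.succ_injective n).injOn)
      (fun T => insert 0 (T.map (Fin.succEmb n))) (by simp) (by simp) ?_ ?_ ?_
    · intro S hS
      ext i
      induction i using Fin.cases <;> simp_all
    · intro T _
      ext i
      simp
    · intro S hS
      congr 1
      ext i
      induction i using Fin.cases <;> simp_all
  · refine Finset.sum_nbij' (fun S => S.preimage Fin.succ (Fin.succ_injective n).injOn)
      (fun T => T.map (Fin.succEmb n)) (by simp) (by simp) ?_ ?_ ?_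
    · intro S hS
      ext i
      induction i using Fin.cases <;> simp_all
    · intro T _
      ext i
      simp
    · intro S hS
      congr 1
      ext i
      induction i using Fin.cases <;> simp_all

/-- All superlevel sets `{x | c ≤ f x}` with `c ≠ -∞` are compact. -/
def HasCompactSuperlevels {E : Type*} [TopologicalSpace E] (f : E → EReal) : Prop :=
  ∀ c : EReal, c ≠ ⊥ → IsCompact {x | c ≤ f x}

/-! ### Compact superlevel sets: fibre maxima and integrability -/

section CompactSuperlevels

variable {E F ι : Type*} [TopologicalSpace E] [TopologicalSpace F]

theorem HasCompactSuperlevels.upperSemicontinuous [T2Space E] {f : E → EReal}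
    (hf : HasCompactSuperlevels f) : UpperSemicontinuous f := by
  rw [upperSemicontinuous_iff_isClosed_preimage]
  intro c
  by_cases hc : c = ⊥
  · simp [hc]
  · exact (hf c hc).isClosed

theorem HasCompactSuperlevels.comp_homeomorph {f : E → EReal} (hf : HasCompactSuperlevels f)
    (e : F ≃ₜ E) : HasCompactSuperlevels (f ∘ e) := fun c hc =>
  e.isCompact_preimage.2 (hf c hc)

/-- On every fibre of a continuous map, a function with compact superlevel sets has a maximum. -/
theorem HasCompactSuperlevels.exists_max_fiber [T2Space E] [T1Space F] {f : E → EReal}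
    (hf : HasCompactSuperlevels f) {p : E → F} (hp : Continuous p) (x : E) :
    ∃ y, p y = p x ∧ ∀ z, p z = p x → f z ≤ f y := by
  by_cases hbot : ∀ z, p z = p x → f z = ⊥
  · exact ⟨x, rfl, fun z hz => (hbot z hz).le.trans bot_le⟩
  push Not at hbot
  obtain ⟨w, hw, hwb⟩ := hbot
  obtain ⟨y, hy, hmax⟩ := UpperSemicontinuousOn.exists_isMaxOn
    (s := {z | f w ≤ f z} ∩ p ⁻¹' {p x}) ⟨w, le_refl (f w), hw⟩
    ((hf _ hwb).inter_right (isClosed_singleton.preimage hp))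
    (hf.upperSemicontinuous.upperSemicontinuousOn _)
  refine ⟨y, hy.2, fun z hz => ?_⟩
  by_cases hwz : f w ≤ f z
  · exact hmax ⟨hwz, hz⟩
  · exact (not_le.1 hwz).le.trans hy.1

/-- A point with nonzero `toReal` has a finite value, hence a value at least `-C`. The support
therefore lies in a single compact superlevel set, on which the function is bounded. -/
theorem HasCompactSuperlevels.integrable_toReal [T2Space E] [MeasurableSpace E]
    [OpensMeasurableSpace E] {μ : Measure E} [IsFiniteMeasureOnCompacts μ] {f : E → EReal}
    (hf : HasCompactSuperlevels f) {C : ℝ} (hC : ∀ x, |(f x).toReal| ≤ C) :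
    Integrable (fun x => (f x).toReal) μ := by
  have hmeas : Measurable fun x => (f x).toReal := by
    refine Measurable.ereal_toReal (measurable_of_Ici fun c => ?_)
    exact (hf.upperSemicontinuous.isClosed_preimage c).measurableSet
  have hK := hf ((-C : ℝ) : EReal) (EReal.coe_ne_bot _)
  rw [← integrableOn_iff_integrable_of_support_subset (s := {x | ((-C : ℝ) : EReal) ≤ f x})]
  · exact Measure.integrableOn_of_bounded hK.measure_lt_top.ne hmeas.aestronglyMeasurable
      (Filter.Eventually.of_forall hC)
  · intro x hx
    have h1 : f x ≠ ⊥ := fun h => hx (by simp [h])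
    have h2 : f x ≠ ⊤ := fun h => hx (by simp [h])
    rw [Set.mem_ofPred_eq, ← EReal.coe_toReal h2 h1]
    exact_mod_cast neg_le_of_abs_le (hC x)

theorem hasCompactSuperlevels_extendBot {Q : Set E} (hQ : IsCompact Q) (hQc : IsClosed Q)
    {g : E → ℝ} (hg : ContinuousOn g Q) : HasCompactSuperlevels (extendBot Q g) := by
  intro c hc
  have h : {x | c ≤ extendBot Q g x} = Q ∩ (fun x => (g x : EReal)) ⁻¹' Set.Ici c := by
    ext x
    by_cases hx : x ∈ Q
    · simp [extendBot_of_mem hx, hx]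
    · simp [extendBot_of_notMem hx, hx, hc]
  rw [h]
  exact hQ.of_isClosed_subset ((continuous_coe_real_ereal.comp_continuousOn
    hg).preimage_isClosed_of_isClosed hQc isClosed_Ici) Set.inter_subset_left

theorem exists_directImage_eq [AddCommGroup E] [Module ℝ E] [AddCommGroup F] [Module ℝ F]
    [T2Space E] [T1Space F] {f : E → EReal} (hf : HasCompactSuperlevels f) {π : E →ₗ[ℝ] F}
    (hπ : Continuous π) (hs : Function.Surjective π) (x : F) :
    ∃ y, π y = x ∧ (∀ z, π z = x → f z ≤ f y) ∧ f y = directImage π f x := by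
  obtain ⟨x, rfl⟩ := hs x
  obtain ⟨y, hy, hmax⟩ := hf.exists_max_fiber hπ x
  exact ⟨y, hy, hmax, le_antisymm (hy ▸ le_directImage π f y) (iSup_le fun z => hmax z.1 z.2)⟩

end CompactSuperlevels

/-! ### Sup-convolutions of continuous functions on compact sets -/

section SupConv

variable {E ι : Type*} [AddCommGroup E] {S : Finset ι} {Q : ι → Set E} {g : ι → E → ℝ}

/-- The decompositions of `x` with all terms in the domains form a compact set, so a supremum other
than `⊥` is attained. -/
theorem supConv_extendBot_eq_bot_or [TopologicalSpace E] [ContinuousAdd E] [T1Space E]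
    (hQ : ∀ i, IsCompact (Q i)) (hg : ∀ i, ContinuousOn (g i) (Q i)) (x : E) :
    supConv S (fun i => extendBot (Q i) (g i)) x = ⊥ ∨
      ∃ y : ι → E, (∀ i ∈ S, y i ∈ Q i) ∧ (∀ i ∉ S, y i = 0) ∧ ∑ i ∈ S, y i = x ∧
        supConv S (fun i => extendBot (Q i) (g i)) x = ((∑ i ∈ S, g i (y i) : ℝ) : EReal) := by
  classical
  rw [or_iff_not_imp_left]
  intro hbot
  -- Coordinates outside `S` do not affect the sum; pinning them to `0` makes the set of candidates
  -- compact in the full product.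
  have hD : IsCompact (Set.univ.pi fun i => if i ∈ S then Q i else {0}) :=
    isCompact_univ_pi fun i => by
      split_ifs
      exacts [hQ i, isCompact_singleton]
  set D : Set (ι → E) := Set.univ.pi fun i => if i ∈ S then Q i else {0}
  have hmemD : ∀ y, y ∈ D ↔ (∀ i ∈ S, y i ∈ Q i) ∧ ∀ i ∉ S, y i = 0 := by
    intro y
    simp only [D, Set.mem_univ_pi]
    constructor
    · intro h
      exact ⟨fun i hi => by simpa [hi] using h i, fun i hi => by simpa [hi] using h i⟩
    · rintro ⟨h1, h2⟩ i
      by_cases hi : i ∈ S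
      · simpa [hi] using h1 i hi
      · simpa [hi] using h2 i hi
  have hK : IsCompact (D ∩ (fun y : ι → E => ∑ i ∈ S, y i) ⁻¹' {x}) :=
    hD.inter_right (isClosed_singleton.preimage
      (continuous_finsetSum _ fun i _ => continuous_apply i))
  have hcont : ContinuousOn (fun y : ι → E => ∑ i ∈ S, g i (y i)) D :=
    continuousOn_finsetSum _ fun i hi => (hg i).comp (continuous_apply i).continuousOn
      fun y hy => ((hmemD y).1 hy).1 i hi
  have hle : ∀ y : ι → E, ∑ i ∈ S, y i = x →
      ∑ i ∈ S, extendBot (Q i) (g i) (y i) ≠ ⊥ → ∃ z ∈ D, ∑ i ∈ S, z i = x ∧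
      ∑ i ∈ S, extendBot (Q i) (g i) (y i) = ((∑ i ∈ S, g i (z i) : ℝ) : EReal) := by
    intro y hy hne
    have hyQ : ∀ i ∈ S, y i ∈ Q i := fun i hi => by
      by_contra hcon
      exact hne (EReal.sum_eq_bot_of_mem (f := fun i => extendBot (Q i) (g i) (y i)) hi
        (extendBot_of_notMem hcon))
    have hyz : ∀ i ∈ S, (if i ∈ S then y i else 0) = y i := fun i hi => if_pos hi
    refine ⟨fun i => if i ∈ S then y i else 0, (hmemD _).2 ⟨fun i hi => ?_, fun i hi => if_neg hi⟩,
      ?_, ?_⟩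
    · rw [hyz i hi]
      exact hyQ i hi
    · rw [Finset.sum_congr rfl hyz, hy]
    · rw [sum_extendBot hyQ]
      exact congrArg _ (Finset.sum_congr rfl fun i hi => by simp only [hyz i hi])
  have hne : (D ∩ (fun y : ι → E => ∑ i ∈ S, y i) ⁻¹' {x}).Nonempty := by
    by_contra hcon
    refine hbot (eq_bot_iff.2 (iSup_le fun ⟨y, hy⟩ => ?_))
    by_contra hle'
    obtain ⟨z, hz, hzx, -⟩ := hle y hy fun h => hle' h.le
    exact hcon ⟨z, hz, hzx⟩
  obtain ⟨y, hy, hmax⟩ := hK.exists_isMaxOn hne (hcont.mono Set.inter_subset_left)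
  have hyD := (hmemD y).1 hy.1
  refine ⟨y, hyD.1, hyD.2, hy.2, le_antisymm (iSup_le fun ⟨w, hw⟩ => ?_) ?_⟩
  · by_cases hwb : ∑ i ∈ S, extendBot (Q i) (g i) (w i) = ⊥
    · exact hwb.le.trans bot_le
    · obtain ⟨z, hz, hzx, hzw⟩ := hle w hw hwb
      rw [hzw]
      exact_mod_cast hmax ⟨hz, hzx⟩
  · rw [← sum_extendBot hyD.1]
    have h := le_supConv S (fun i => extendBot (Q i) (g i)) y
    rwa [show ∑ i ∈ S, y i = x from hy.2] at h

/-- Since suprema are attained, a superlevel set is the image under summation of a compact set of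
decompositions. -/
theorem hasCompactSuperlevels_supConv [TopologicalSpace E] [ContinuousAdd E] [T2Space E]
    (hQ : ∀ i, IsCompact (Q i)) (hg : ∀ i, ContinuousOn (g i) (Q i)) :
    HasCompactSuperlevels (supConv S fun i => extendBot (Q i) (g i)) := by
  classical
  intro c hc
  have hD : IsCompact (Set.univ.pi fun i => if i ∈ S then Q i else {0}) :=
    isCompact_univ_pi fun i => by
      split_ifs
      exacts [hQ i, isCompact_singleton]
  set D : Set (ι → E) := Set.univ.pi fun i => if i ∈ S then Q i else {0}
  have hmemD : ∀ y ∈ D, ∀ i ∈ S, y i ∈ Q i := fun y hy i hi => by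
    simpa [hi] using hy i (Set.mem_univ i)
  have hcont : ContinuousOn (fun y : ι → E => ((∑ i ∈ S, g i (y i) : ℝ) : EReal)) D :=
    continuous_coe_real_ereal.comp_continuousOn
      (continuousOn_finsetSum _ fun i hi => (hg i).comp (continuous_apply i).continuousOn
        fun y hy => hmemD y hy i hi)
  have himage : {x | c ≤ supConv S (fun i => extendBot (Q i) (g i)) x} =
      (fun y : ι → E => ∑ i ∈ S, y i) ''
        (D ∩ (fun y : ι → E => ((∑ i ∈ S, g i (y i) : ℝ) : EReal)) ⁻¹' Set.Ici c) := by
    ext x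
    constructor
    · intro hx
      rcases supConv_extendBot_eq_bot_or (S := S) hQ hg x with hb | ⟨y, hyQ, hy0, hyx, hy⟩
      · rw [Set.mem_ofPred_eq, hb] at hx
        exact absurd (le_bot_iff.1 hx) hc
      · refine ⟨y, ⟨fun i _ => ?_, ?_⟩, hyx⟩
        · by_cases hi : i ∈ S
          · simpa [hi] using hyQ i hi
          · simpa [hi] using hy0 i hi
        · rw [Set.mem_ofPred_eq, hy] at hx
          exact hx
    · rintro ⟨y, ⟨hyD, hy⟩, rfl⟩
      refine le_trans (show c ≤ _ from hy) ?_
      beta_reduce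
      rw [← sum_extendBot (hmemD y hyD)]
      exact le_supConv S (fun i => extendBot (Q i) (g i)) y
  rw [himage]
  exact (hD.of_isClosed_subset (hcont.preimage_isClosed_of_isClosed
    (isClosed_set_pi fun i _ => by
      split_ifs
      exacts [(hQ i).isClosed, isClosed_singleton]) isClosed_Ici)
    Set.inter_subset_left).image (continuous_finsetSum _ fun i _ => continuous_apply i)

theorem exists_abs_toReal_supConv_le [TopologicalSpace E] [ContinuousAdd E] [T2Space E]
    (hQ : ∀ i, IsCompact (Q i)) (hg : ∀ i, ContinuousOn (g i) (Q i)) :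
    ∃ C : ℝ, ∀ x, |(supConv S (fun i => extendBot (Q i) (g i)) x).toReal| ≤ C := by
  choose C hC using fun i => (hQ i).exists_bound_of_continuousOn (hg i)
  -- The absolute values keep the bound nonnegative, as needed where the sup-convolution is `⊥` and
  -- its `toReal` is `0`.
  refine ⟨∑ i ∈ S, |C i|, fun x => ?_⟩
  rcases supConv_extendBot_eq_bot_or (S := S) hQ hg x with hb | ⟨y, hyQ, -, -, hy⟩
  · rw [hb]
    simpa using Finset.sum_nonneg fun i _ => abs_nonneg (C i)
  · rw [hy, EReal.toReal_coe]
    exact (Finset.abs_sum_le_sum_abs _ _).trans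
      (Finset.sum_le_sum fun i hi => (hC i _ (hyQ i hi)).trans (le_abs_self _))

/-- A sup-convolution of continuous concave functions on compact sets is quasi-concave. -/
theorem min_le_supConv [Module ℝ E] [TopologicalSpace E] [ContinuousAdd E] [T2Space E]
    (hQ : ∀ i, IsCompact (Q i)) (hg : ∀ i, ContinuousOn (g i) (Q i))
    (hconc : ∀ i, ConcaveOn ℝ (Q i) (g i)) (x z : E) {a b : ℝ} (ha : 0 ≤ a) (hb : 0 ≤ b)
    (hab : a + b = 1) :
    min (supConv S (fun i => extendBot (Q i) (g i)) x)
        (supConv S (fun i => extendBot (Q i) (g i)) z) ≤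
      supConv S (fun i => extendBot (Q i) (g i)) (a • x + b • z) := by
  rcases supConv_extendBot_eq_bot_or (S := S) hQ hg x with h | ⟨y, hyQ, -, hyx, hy⟩
  · simp [h]
  rcases supConv_extendBot_eq_bot_or (S := S) hQ hg z with h | ⟨w, hwQ, -, hwz, hw⟩
  · simp [h]
  have hmem : ∀ i ∈ S, (fun i => a • y i + b • w i) i ∈ Q i := fun i hi =>
    (hconc i).1 (hyQ i hi) (hwQ i hi) ha hb hab
  have hsum : ∑ i ∈ S, (a • y i + b • w i) = a • x + b • z := by
    rw [Finset.sum_add_distrib, ← Finset.smul_sum, ← Finset.smul_sum, hyx, hwz]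
  have hle := le_supConv S (fun i => extendBot (Q i) (g i)) fun i => a • y i + b • w i
  rw [sum_extendBot hmem, hsum] at hle
  refine le_trans ?_ hle
  rw [hy, hw]
  have h1 : a * ∑ i ∈ S, g i (y i) + b * ∑ i ∈ S, g i (w i) ≤
      ∑ i ∈ S, g i (a • y i + b • w i) := by
    rw [Finset.mul_sum, Finset.mul_sum, ← Finset.sum_add_distrib]
    exact Finset.sum_le_sum fun i hi => (hconc i).2 (hyQ i hi) (hwQ i hi) ha hb hab
  have h2 : min (∑ i ∈ S, g i (y i)) (∑ i ∈ S, g i (w i)) ≤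
      a * ∑ i ∈ S, g i (y i) + b * ∑ i ∈ S, g i (w i) := by
    simpa using! Convex.min_le_combo (∑ i ∈ S, g i (y i)) (∑ i ∈ S, g i (w i)) ha hb hab
  rw [← EReal.coe_strictMono.monotone.map_min]
  exact_mod_cast h2.trans h1

end SupConv

/-! ### The one-variable computation -/

/-- Sliding a quasi-concave function of one variable along a unit segment increases its integral
by its maximum. -/
theorem integral_iSup_sub {h : ℝ → EReal}
    (hq : ∀ x y z, x ≤ y → y ≤ z → min (h x) (h z) ≤ h y)
    (hint : Integrable fun s => (h s).toReal) {c : ℝ} (hc : ∀ s, h s ≤ h c) :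
    ∫ s, (⨆ t : Set.Icc (0 : ℝ) 1, h (s - t)).toReal =
      (∫ s, (h s).toReal) + (h c).toReal := by
  have hmono : ∀ x y, x ≤ y → y ≤ c → h x ≤ h y := fun x y hxy hyc =>
    (le_min le_rfl (hc x)).trans (hq x y c hxy hyc)
  have hanti : ∀ x y, c ≤ x → x ≤ y → h y ≤ h x := fun x y hcx hxy =>
    (le_min (hc y) le_rfl).trans (hq c x y hcx hxy)
  -- Since `h` increases up to `c` and decreases afterwards, `H` equals `h` left of `c`, the maximum
  -- on `(c, c + 1]`, and the translate of `h` by `1` beyond.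
  set H : ℝ → ℝ := fun s => (⨆ t : Set.Icc (0 : ℝ) 1, h (s - t)).toReal
  have h1 : ∀ s ∈ Set.Iic c, H s = (h s).toReal := by
    intro s hs
    refine congrArg EReal.toReal (le_antisymm (iSup_le fun t => ?_) ?_)
    · exact hmono _ _ (by linarith [t.2.1]) hs
    · simpa using le_iSup (fun t : Set.Icc (0 : ℝ) 1 => h (s - t)) ⟨0, by simp⟩
  have h2 : ∀ s ∈ Set.Ioc c (c + 1), H s = (h c).toReal := by
    intro s hs
    refine congrArg EReal.toReal (le_antisymm (iSup_le fun t => hc _) ?_)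
    simpa using le_iSup (fun t : Set.Icc (0 : ℝ) 1 => h (s - t))
      ⟨s - c, by linarith [hs.1], by linarith [hs.2]⟩
  have h3 : ∀ s ∈ Set.Ioi (c + 1), H s = (h (s - 1)).toReal := by
    intro s hs
    rw [Set.mem_Ioi] at hs
    refine congrArg EReal.toReal (le_antisymm (iSup_le fun t => ?_) ?_)
    · exact hanti _ _ (by linarith) (by linarith [t.2.2])
    · simpa using le_iSup (fun t : Set.Icc (0 : ℝ) 1 => h (s - t)) ⟨1, by simp⟩
  have hint' : Integrable fun s => (h (s - 1)).toReal := hint.comp_sub_right 1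
  have i1 : IntegrableOn H (Set.Iic c) :=
    (integrableOn_congr_fun h1 measurableSet_Iic).2 hint.integrableOn
  have i2 : IntegrableOn H (Set.Ioc c (c + 1)) :=
    (integrableOn_congr_fun h2 measurableSet_Ioc).2 (integrableOn_const (by simp))
  have i3 : IntegrableOn H (Set.Ioi (c + 1)) :=
    (integrableOn_congr_fun h3 measurableSet_Ioi).2 hint'.integrableOn
  have hu : Set.Ioc c (c + 1) ∪ Set.Ioi (c + 1) = Set.Ioi c :=
    Set.Ioc_union_Ioi_eq_Ioi (by linarith)
  have hdisj : Disjoint (Set.Ioc c (c + 1)) (Set.Ioi (c + 1)) := Set.Ioc_disjoint_Ioi le_rfl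
  have i23 : IntegrableOn H (Set.Ioi c) := hu ▸ i2.union i3
  have e3 : ∫ s in Set.Ioi (c + 1), (h (s - 1)).toReal = ∫ s in Set.Ioi c, (h s).toReal := by
    rw [← integral_indicator measurableSet_Ioi, ← integral_indicator measurableSet_Ioi,
      ← integral_sub_right_eq_self ((Set.Ioi c).indicator fun s => (h s).toReal) (1 : ℝ)]
    congr 1
    funext s
    simp only [Set.indicator_apply, Set.mem_Ioi, lt_sub_iff_add_lt]
  rw [← intervalIntegral.integral_Iic_add_Ioi i1 i23, ← hu,
    setIntegral_union hdisj measurableSet_Ioi i2 i3,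
    setIntegral_congr_fun measurableSet_Iic h1, setIntegral_congr_fun measurableSet_Ioc h2,
    setIntegral_congr_fun measurableSet_Ioi h3, e3,
    ← intervalIntegral.integral_Iic_add_Ioi (b := c) hint.integrableOn hint.integrableOn]
  simp
  ring

/-! ### Lattice coordinates adapted to `m`, and Fubini -/

section Lattice

variable {L ι : Type*} [AddCommGroup L]

instance RealSpace.instContinuousAdd : ContinuousAdd (RealSpace L) :=
  IsModuleTopology.toContinuousAdd ℝ (RealSpace L)

theorem RealSpace.map_of {L' : Type*} [AddCommGroup L'] (p : L →+ L') (x : L) :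
    RealSpace.map p (RealSpace.of x) = RealSpace.of (p x) :=
  LinearMap.baseChange_tmul _ _ _

theorem RealSpace.basis_apply (b : Module.Basis ι ℤ L) (i : ι) :
    RealSpace.basis b i = RealSpace.of (b i) :=
  Algebra.TensorProduct.basis_apply b i

/-- The coordinates on `L_ℝ` given by a `ℤ`-basis of `L`. -/
noncomputable def RealSpace.coord [Fintype ι] (b : Module.Basis ι ℤ L) :
    RealSpace L ≃L[ℝ] (ι → ℝ) where
  toLinearEquiv := (RealSpace.basis b).equivFun
  continuous_toFun := IsModuleTopology.continuous_of_linearMap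
    (RealSpace.basis b).equivFun.toLinearMap
  continuous_invFun := IsModuleTopology.continuous_of_linearMap
    (RealSpace.basis b).equivFun.symm.toLinearMap

theorem RealSpace.coord_symm_apply [Fintype ι] (b : Module.Basis ι ℤ L) (x : ι → ℝ) :
    (RealSpace.coord b).symm x = ∑ i, x i • RealSpace.of (b i) := by
  simp only [← RealSpace.basis_apply]
  exact (RealSpace.basis b).equivFun_symm_apply x

instance RealSpace.instT2Space [Module.Free ℤ L] [Module.Finite ℤ L] : T2Space (RealSpace L) :=
  (RealSpace.coord (Module.Free.chooseBasis ℤ L)).symm.toHomeomorph.t2Space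

theorem integral_latticeVolume [Fintype ι] [Module.Free ℤ L] [Module.Finite ℤ L]
    (b : Module.Basis ι ℤ L) (f : RealSpace L → ℝ) :
    ∫ x, f x ∂latticeVolume L = ∫ x : ι → ℝ, f ((RealSpace.coord b).symm x) := by
  rw [latticeVolume_eq b]
  exact (RealSpace.coord b).symm.toHomeomorph.measurableEmbedding.integral_map f

/-- Coordinates turn von Neumann boundedness into metric boundedness, so that Heine–Borel applies.
-/
theorem IsPolytope.isCompact [Module.Free ℤ L] [Module.Finite ℤ L] {Q : Set (RealSpace L)}
    (hQ : IsPolytope Q) : IsCompact Q := by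
  obtain ⟨⟨s, hs⟩, hbdd⟩ := hQ
  have hclosed : IsClosed Q := by
    have h : Q = ⋂ p ∈ s, {x | 0 ≤ p.1 x + p.2} := by
      rw [hs]
      ext x
      simp
    rw [h]
    exact isClosed_biInter fun p _ => isClosed_le continuous_const
      ((IsModuleTopology.continuous_of_linearMap p.1).add continuous_const)
  let e := RealSpace.coord (Module.Free.chooseBasis ℤ L)
  have h1 : IsCompact (e '' Q) := Metric.isCompact_of_isClosed_isBounded
    (e.toHomeomorph.isClosedMap _ hclosed)
    (NormedSpace.isVonNBounded_iff ℝ |>.1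
      (hbdd.image (e : RealSpace L →L[ℝ] Module.Free.ChooseBasisIndex ℤ L → ℝ)))
  have h2 := h1.image e.symm.continuous
  rwa [Set.image_image, Set.image_congr fun x _ => e.symm_apply_apply x, Set.image_id'] at h2

/-- A basis of the quotient of a lattice by a nonzero vector `m` lifts to a basis of the lattice
whose first vector is `m`. -/
theorem exists_basis_of_quotient [Module.IsTorsionFree ℤ L] {m : L} (hm : m ≠ 0) {k : ℕ}
    (c : Module.Basis (Fin k) ℤ (L ⧸ AddSubgroup.zmultiples m)) :
    ∃ b : Module.Basis (Fin (k + 1)) ℤ L, b 0 = m ∧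
      ∀ i : Fin k, QuotientAddGroup.mk' (AddSubgroup.zmultiples m) (b i.succ) = c i := by
  choose v hv using fun i => QuotientAddGroup.mk'_surjective (AddSubgroup.zmultiples m) (c i)
  have hpm : QuotientAddGroup.mk' (AddSubgroup.zmultiples m) m = 0 :=
    (QuotientAddGroup.eq_zero_iff m).2 (AddSubgroup.mem_zmultiples m)
  have hli : LinearIndependent ℤ (Fin.cons m v : Fin (k + 1) → L) := by
    rw [Fintype.linearIndependent_iff]
    intro a ha
    rw [Fin.sum_univ_succ] at ha
    simp only [Fin.cons_zero, Fin.cons_succ] at ha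
    have h1 := congrArg (QuotientAddGroup.mk' (AddSubgroup.zmultiples m)) ha
    simp only [map_add, map_zsmul, map_sum, hpm, hv, smul_zero, zero_add, map_zero] at h1
    have h2 : ∀ i : Fin k, a i.succ = 0 := Fintype.linearIndependent_iff.1 c.linearIndependent _ h1
    simp only [h2, zero_smul, Finset.sum_const_zero, add_zero] at ha
    exact Fin.cases ((smul_eq_zero.1 ha).resolve_right hm) h2
  have hsp : ⊤ ≤ Submodule.span ℤ (Set.range (Fin.cons m v : Fin (k + 1) → L)) := by
    intro z _
    set p := QuotientAddGroup.mk' (AddSubgroup.zmultiples m) with hp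
    have h1 : p (z - ∑ i, c.repr (p z) i • v i) = 0 := by
      rw [map_sub, map_sum]
      simp only [map_zsmul, hv]
      rw [c.sum_repr, sub_self]
    obtain ⟨j, hj⟩ := AddSubgroup.mem_zmultiples_iff.1 ((QuotientAddGroup.eq_zero_iff _).1 h1)
    rw [eq_sub_iff_add_eq] at hj
    rw [← hj]
    refine Submodule.add_mem _ (Submodule.smul_mem _ _ (Submodule.subset_span ⟨0, rfl⟩))
      (Submodule.sum_mem _ fun i _ => Submodule.smul_mem _ _ (Submodule.subset_span ⟨i.succ, ?_⟩))
    simp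
  refine ⟨Module.Basis.mk hli hsp, by simp, fun i => ?_⟩
  simp [hv]

theorem coe_piFinSuccAbove_zero_symm (k : ℕ) :
    ⇑(MeasurableEquiv.piFinSuccAbove (fun _ : Fin (k + 1) => ℝ) 0).symm =
      fun z : ℝ × (Fin k → ℝ) => (Fin.cons z.1 z.2 : Fin (k + 1) → ℝ) := by
  funext z
  simp [MeasurableEquiv.piFinSuccAbove_symm_apply]
  rfl

theorem measurePreserving_finCons (k : ℕ) :
    MeasurePreserving (fun z : ℝ × (Fin k → ℝ) => (Fin.cons z.1 z.2 : Fin (k + 1) → ℝ))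
      (volume.prod volume) volume := by
  rw [← coe_piFinSuccAbove_zero_symm]
  exact (volume_preserving_piFinSuccAbove (fun _ : Fin (k + 1) => ℝ) 0).symm _

theorem measurableEmbedding_finCons (k : ℕ) :
    MeasurableEmbedding
      (fun z : ℝ × (Fin k → ℝ) => (Fin.cons z.1 z.2 : Fin (k + 1) → ℝ)) := by
  rw [← coe_piFinSuccAbove_zero_symm]
  exact MeasurableEquiv.measurableEmbedding _

/-- Sliding a quasi-concave function along a lattice vector that splits off increases its integral by the
integral of its direct image under the projection along this vector. -/
theorem integral_iSup_sub_smul [Module.Free ℤ L] [Module.Finite ℤ L] {m : L} (hm : m ≠ 0)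
    [Module.Free ℤ (L ⧸ AddSubgroup.zmultiples m)] {h : RealSpace L → EReal}
    (hcpt : HasCompactSuperlevels h)
    (hbdd : ∃ C : ℝ, ∀ x, |(h x).toReal| ≤ C)
    (hq : ∀ x z, ∀ a b : ℝ, 0 ≤ a → 0 ≤ b → a + b = 1 → min (h x) (h z) ≤ h (a • x + b • z))
    {H : RealSpace L → EReal}
    (hH : ∀ x, H x = ⨆ t : Set.Icc (0 : ℝ) 1, h (x - (t : ℝ) • RealSpace.of m))
    (hHcpt : HasCompactSuperlevels H) (hHbdd : ∃ C : ℝ, ∀ x, |(H x).toReal| ≤ C) :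
    ∫ x, (H x).toReal ∂latticeVolume L = ∫ x, (h x).toReal ∂latticeVolume L +
      ∫ x, (directImage (RealSpace.map (QuotientAddGroup.mk' (AddSubgroup.zmultiples m)))
        h x).toReal ∂latticeVolume (L ⧸ AddSubgroup.zmultiples m) := by
  set π := RealSpace.map (QuotientAddGroup.mk' (AddSubgroup.zmultiples m)) with hπ
  have hcont : Continuous π := IsModuleTopology.continuous_of_linearMap π
  let c := Module.finBasis ℤ (L ⧸ AddSubgroup.zmultiples m)
  set k := Module.finrank ℤ (L ⧸ AddSubgroup.zmultiples m)
  obtain ⟨b, hb0, hbs⟩ := exists_basis_of_quotient hm c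
  let B := RealSpace.coord b
  let D := RealSpace.coord c
  -- In the coordinates `(s, p)`, `s` runs along `m` and `p` parametrizes the quotient, so `π`
  -- becomes `(s, p) ↦ p`.
  let e : ℝ → (Fin k → ℝ) → RealSpace L := fun s p => B.symm (Fin.cons s p : Fin (k + 1) → ℝ)
  have he : ∀ s p, e s p = s • RealSpace.of m + ∑ i, p i • RealSpace.of (b i.succ) := by
    intro s p
    simp only [e, B, RealSpace.coord_symm_apply, Fin.sum_univ_succ, Fin.cons_zero, Fin.cons_succ,
      hb0]
  have hπm : π (RealSpace.of m) = 0 := by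
    rw [hπ, RealSpace.map_of, show QuotientAddGroup.mk' (AddSubgroup.zmultiples m) m = 0 from
      (QuotientAddGroup.eq_zero_iff m).2 (AddSubgroup.mem_zmultiples m)]
    exact TensorProduct.tmul_zero _ _
  have hπe : ∀ s p, π (e s p) = D.symm p := by
    intro s p
    rw [he, map_add, map_smul, hπm, smul_zero, zero_add, map_sum, RealSpace.coord_symm_apply]
    refine Finset.sum_congr rfl fun i _ => ?_
    rw [map_smul, hπ, RealSpace.map_of, hbs]
  have hsurj : Function.Surjective π := fun x => ⟨e 0 (D x), by rw [hπe, D.symm_apply_apply]⟩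
  have hsub : ∀ s t p, e s p - t • RealSpace.of m = e (s - t) p := by
    intro s t p
    rw [he, he, sub_smul]
    abel
  have hcombo : ∀ (a₁ a₂ s₁ s₂ : ℝ) (p : Fin k → ℝ), a₁ + a₂ = 1 →
      a₁ • e s₁ p + a₂ • e s₂ p = e (a₁ * s₁ + a₂ * s₂) p := by
    intro a₁ a₂ s₁ s₂ p ha
    simp only [he, smul_add, add_smul, mul_smul]
    rw [add_add_add_comm, ← add_smul a₁ a₂ (∑ i, p i • RealSpace.of (b i.succ)), ha, one_smul]
  have hint : ∀ f : RealSpace L → EReal, HasCompactSuperlevels f →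
      (∃ C : ℝ, ∀ x, |(f x).toReal| ≤ C) →
      Integrable (fun z : ℝ × (Fin k → ℝ) => (f (e z.1 z.2)).toReal) (volume.prod volume) ∧
      ∫ x, (f x).toReal ∂latticeVolume L = ∫ p, ∫ s, (f (e s p)).toReal := by
    intro f hf ⟨C, hC⟩
    have h1 : Integrable (fun x : Fin (k + 1) → ℝ => (f (B.symm x)).toReal) :=
      (hf.comp_homeomorph B.symm.toHomeomorph).integrable_toReal fun x => hC (B.symm x)
    have h2 : Integrable (fun z : ℝ × (Fin k → ℝ) => (f (e z.1 z.2)).toReal)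
        (volume.prod volume) := (measurePreserving_finCons k).integrable_comp_of_integrable h1
    refine ⟨h2, ?_⟩
    rw [integral_latticeVolume b, ← integral_prod_symm _ h2]
    exact ((measurePreserving_finCons k).integral_comp (measurableEmbedding_finCons k) _).symm
  obtain ⟨hi, hI⟩ := hint h hcpt hbdd
  obtain ⟨hHi, hHI⟩ := hint H hHcpt hHbdd
  -- Only almost every `p` is claimed: the one-variable lemma needs `h` integrable on the line over
  -- `p`, which Fubini gives almost everywhere.
  have key : ∀ᵐ p : Fin k → ℝ, ∫ s, (H (e s p)).toReal =
      (∫ s, (h (e s p)).toReal) + (directImage π h (D.symm p)).toReal := by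
    filter_upwards [hi.prod_left_ae] with p hp
    obtain ⟨y, hy, hmax, hval⟩ := exists_directImage_eq hcpt hcont hsurj (D.symm p)
    -- The fibre of `π` over `D.symm p` is exactly the line `s ↦ e s p`, so the fibre maximum is a
    -- maximum on that line.
    obtain ⟨s₀, rfl⟩ : ∃ s₀, e s₀ p = y := by
      refine ⟨B y 0, ?_⟩
      have h1 : e (B y 0) (Fin.tail (B y)) = y := by
        simp only [e, Fin.cons_self_tail, B.symm_apply_apply]
      rw [← h1, hπe] at hy
      rw [← D.symm.injective hy, h1]
    rw [← hval]
    simp only [hH, hsub]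
    refine integral_iSup_sub (h := fun s => h (e s p)) (fun x y z hxy hyz => ?_) hp
      fun s => hmax _ (hπe s p)
    rcases eq_or_lt_of_le (hxy.trans hyz) with hxz | hxz
    · rw [le_antisymm hxy (hyz.trans hxz.ge)]
      exact min_le_left _ _
    · have hpos : 0 < z - x := sub_pos.2 hxz
      have h1 := hq (e x p) (e z p) ((z - y) / (z - x)) ((y - x) / (z - x))
        (div_nonneg (by linarith) hpos.le) (div_nonneg (by linarith) hpos.le)
        (by field_simp; ring)
      rwa [hcombo _ _ _ _ _ (by field_simp; ring),
        show (z - y) / (z - x) * x + (y - x) / (z - x) * z = y by field_simp; ring] at h1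
  -- By `key` the direct image is almost everywhere the difference of the fibre integrals of `H` and
  -- `h`, both integrable by Fubini.
  have hψ : Integrable fun p => (directImage π h (D.symm p)).toReal := by
    refine (hHi.integral_prod_right.sub hi.integral_prod_right).congr ?_
    filter_upwards [key] with p hp
    rw [Pi.sub_apply, hp, add_sub_cancel_left]
  rw [hHI, hI, integral_latticeVolume c, integral_congr_ae key]
  exact integral_add hi.integral_prod_right hψ

end Lattice

/-! ### Assembling the alternating sums -/

theorem supConv_concaveIndicator_segment_toReal {E : Type*} [AddCommGroup E] [Module ℝ E] {n : ℕ}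
    (m : E) (f : Fin n → E → EReal) (x : E) :
    (supConv {0} (Fin.cons (α := fun _ => E → EReal) (concaveIndicator (segment ℝ 0 m)) f)
      x).toReal = 0 := by
  have h : supConv {0} (Fin.cons (α := fun _ => E → EReal) (concaveIndicator (segment ℝ 0 m)) f)
      x = concaveIndicator (segment ℝ 0 m) x := by
    refine le_antisymm (iSup_le fun ⟨y, hy⟩ => ?_) ?_
    · simp only [Finset.sum_singleton, Fin.cons_zero] at hy ⊢
      rw [hy]
    · simpa using le_supConv {0}
        (Fin.cons (α := fun _ => E → EReal) (concaveIndicator (segment ℝ 0 m)) f) fun _ => x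
  rw [h]
  by_cases hx : x ∈ segment ℝ 0 m
  · simp [concaveIndicator, extendBot_of_mem hx]
  · simp [concaveIndicator, extendBot_of_notMem hx]

theorem proposition1p8 {M : Type*} [AddCommGroup M] [Module.Free ℤ M] [Module.Finite ℤ M]
    (n : ℕ) (hn : Module.finrank ℤ M = n) (m : M) (hm : IsPrimitiveVector m)
    (Q : Fin n → Set (RealSpace M)) (hQ : ∀ i, IsPolytope (Q i))
    (hQne : ∀ i, (Q i).Nonempty)
    (g : Fin n → RealSpace M → ℝ) (hconc : ∀ i, ConcaveOn ℝ (Q i) (g i))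
    (hcont : ∀ i, ContinuousOn (g i) (Q i)) :
    haveI : Module.Free ℤ (M ⧸ AddSubgroup.zmultiples m) := hm.free_quotient
    latticeMixedIntegral M
        (Fin.cons (α := fun _ => RealSpace M → EReal)
          (concaveIndicator (segment ℝ 0 (RealSpace.of m)))
          (fun i => extendBot (Q i) (g i))) =
      latticeMixedIntegral (M ⧸ AddSubgroup.zmultiples m)
        (fun i => directImage (RealSpace.map (QuotientAddGroup.mk' (AddSubgroup.zmultiples m)))
          (extendBot (Q i) (g i))) := by
  
  have : Module.Free ℤ (M ⧸ AddSubgroup.zmultiples m) := hm.free_quotient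
  have hQc : ∀ i, IsCompact (Q i) := fun i => (hQ i).isCompact
  set π := RealSpace.map (QuotientAddGroup.mk' (AddSubgroup.zmultiples m)) with hπ
  set ι₀ : RealSpace M → EReal := concaveIndicator (segment ℝ 0 (RealSpace.of m))
  set f : Fin n → RealSpace M → EReal := fun i => extendBot (Q i) (g i)
  -- The segment indicator is treated as one more continuous function on a compact set, so the
  -- compactness lemmas also cover the family of `n + 1` functions.
  have hcons : (Fin.cons (α := fun _ => RealSpace M → EReal) ι₀ f) = fun i => extendBot
      (Fin.cons (α := fun _ => Set (RealSpace M)) (segment ℝ 0 (RealSpace.of m)) Q i)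
      (Fin.cons (α := fun _ => RealSpace M → ℝ) (fun _ => 0) g i) := by
    funext i
    induction i using Fin.cases <;> rfl
  have hQc' : ∀ i, IsCompact
      (Fin.cons (α := fun _ => Set (RealSpace M)) (segment ℝ 0 (RealSpace.of m)) Q i) := by
    refine Fin.cases ?_ hQc
    rw [Fin.cons_zero, segment_eq_image']
    refine isCompact_Icc.image ?_
    simp only [zero_add, sub_zero]
    exact IsModuleTopology.continuous_of_linearMap
      (LinearMap.toSpanSingleton ℝ (RealSpace M) (RealSpace.of m))
  have hg' : ∀ i, ContinuousOn (Fin.cons (α := fun _ => RealSpace M → ℝ) (fun _ => 0) g i)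
      (Fin.cons (α := fun _ => Set (RealSpace M)) (segment ℝ 0 (RealSpace.of m)) Q i) :=
    Fin.cases continuousOn_const hcont
  have hslide : ∀ T : Finset (Fin n),
      ∫ x, (supConv (insert 0 (T.map (Fin.succEmb n))) (Fin.cons (α := fun _ => RealSpace M → EReal)
        ι₀ f) x).toReal ∂latticeVolume M =
      ∫ x, (supConv T f x).toReal ∂latticeVolume M +
        ∫ x, (supConv T (fun i => directImage π (f i)) x).toReal
          ∂latticeVolume (M ⧸ AddSubgroup.zmultiples m) := by
    intro T
    have hsurj : Function.Surjective π :=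
      LinearMap.lTensor_surjective ℝ (QuotientAddGroup.mk'_surjective _)
    rw [supConv_directImage fun i x => by
      obtain ⟨y, hy, -, hval⟩ := exists_directImage_eq
        (hasCompactSuperlevels_extendBot (hQc i) (hQc i).isClosed (hcont i))
        (IsModuleTopology.continuous_of_linearMap π) hsurj x
      exact ⟨y, hy, hval⟩]
    refine integral_iSup_sub_smul hm.1 (hasCompactSuperlevels_supConv hQc hcont)
      (exists_abs_toReal_supConv_le hQc hcont)
      (fun x z a b ha hb hab => min_le_supConv hQc hcont hconc x z ha hb hab)
      (fun x => supConv_cons_concaveIndicator _ _ _ _) ?_ ?_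
    · rw [hcons]
      exact hasCompactSuperlevels_supConv hQc' hg'
    · rw [hcons]
      exact exists_abs_toReal_supConv_le hQc' hg'
  unfold latticeMixedIntegral
  rw [mixedIntegral_eq, mixedIntegral_eq, Finset.sum_filter, Finset.sum_filter,
    sum_finset_fin_succ, ← Finset.sum_add_distrib]
  refine Finset.sum_congr rfl fun T _ => ?_
  have hcard : (insert 0 (T.map (Fin.succEmb n))).card = T.card + 1 := by
    rw [Finset.card_insert_of_notMem (by simp [Fin.succ_ne_zero]), Finset.card_map]
  have hT : T.card ≤ n := by simpa using Finset.card_le_univ T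
  rw [if_pos (Finset.insert_nonempty _ _), hcard, Finset.card_map]
  simp only [Finset.map_nonempty]
  by_cases hne : T.Nonempty
  -- The exponents for `T ∪ {0}` and `T` differ by one, so the integrals of `supConv T f` cancel and
  -- the term over the quotient remains.
  · rw [if_pos hne, if_pos hne, hslide, supConv_map,
      show n + 1 - (T.card + 1) = n - T.card by omega,
      show n + 1 - T.card = (n - T.card) + 1 by omega, pow_succ]
    simp only [Fin.coe_succEmb, Fin.cons_succ]
    ring
  -- For empty `T` only the index set `{0}` remains, with no counterpart over the quotient; its
  -- integrand is the segment indicator, whose `toReal` vanishes everywhere.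
  · rw [if_neg hne, if_neg hne, Finset.not_nonempty_iff_eq_empty.1 hne, Finset.map_empty,
      insert_empty_eq]
    simp only [supConv_concaveIndicator_segment_toReal, ι₀]
    simp
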